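/- Let $\mathcal I=\{1,\dots,n,C\}$, let $T>0$, $\mathbb R_+=(0,\infty)$, and let $(\mathbb P_k)_{k\in\mathcal I}$ be equivalent probability measures on a measurable space. For $k\in\mathcal I$ let $v_k$ be a measurable function that is positive a.e. on $\mathbb R_+$, put $\nu_k(d\xi)=v_k(\xi)\,d\xi$, and assume $$\int_{\mathbb R_+}v_k(\xi)\,d\xi<\infty,\qquad \int_{\mathbb R_+}\xi\,v_k(\xi)\,d\xi<\infty,\qquad \int_{\mathbb R_+}\frac{v_C(\xi)^2}{v_k(\xi)}\,d\xi<\infty\qquad(k\in\mathcal I).$$ Let $N(d\xi,dt)$ be a random measure which under each $\mathbb P_k$ is a Poisson random measure on $\mathbb R_+\times(0,T]$ with compensator $\nu_k(d\xi)\,dt$, and let $\tilde N^{\mathbb P_k}(d\xi,dt)=N(d\xi,dt)-\nu_k(d\xi)\,dt$. Let $c,x,\eta,\theta>0$ and let $\pi_k\ge 0$ satisfy $\sum_{k\in\mathcal I}\pi_k=1$. For $t\in\mathbb R$ put $$\ell_k(t)=\exp\Big(t\int_{\mathbb R_+}\Big[1-(1+\eta)\frac{v_C(\xi)}{v_k(\xi)}\Big]^2\nu_k(d\xi)\Big),$$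 and consider the (candidate) optimal controls $$\beta^*(\xi)=(1+\eta)v_C(\xi),\qquad \alpha^*(t,\xi,\boldsymbol z)=\xi-\frac1\theta\sum_{k\in\mathcal I}\pi_k z_k\,\ell_k(T-t)\Big[(1+\eta)\frac{v_C(\xi)}{v_k(\xi)}-1\Big].$$ Consider the following equations on $[0,T]$ for processes $Z^*_k$ ($k\in\mathcal I$) and $X^*$ with càdlàg paths, with $\alpha^*_t(\xi)=\alpha^*(t,\xi,\boldsymbol Z^*_{t^-})$, the integrals being taken path by path and required to exist: $$dZ^*_{k,t}=-Z^*_{k,t^-}\int_{\mathbb R_+}\Big[1-\frac{\beta^*(\xi)}{v_k(\xi)}\Big]\tilde N^{\mathbb P_k}(d\xi,dt),\qquad Z^*_{k,0}=1,\quad k\in\mathcal I,$$ $$X^*_t=x+\int_0^t\Big[c-(1+\eta)\int_{\mathbb R_+}\alpha^*_s(\xi)\,\nu_C(d\xi)\Big]ds-\int_0^t\!\!\int_{\mathbb R_+}[\xi-\alpha^*_s(\xi)]\,N(d\xi,ds).$$ Then, almost surely, $\ln\big((1+\eta)v_C(\xi)/v_k(\xi)\big)$ is $N$-integrable on $\mathbb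 R_+\times(0,T]$ for every $k\in\mathcal I$; and processes $(Z^*_k)_{k\in\mathcal I}$, $X^*$ solve these equations if and only if, almost surely, for all $t\in[0,T]$, $$Z^*_{k,t}=\exp\Big(t\int_{\mathbb R_+}\big[v_k(\xi)-(1+\eta)v_C(\xi)\big]d\xi+\int_0^t\!\!\int_{\mathbb R_+}\ln\Big((1+\eta)\frac{v_C(\xi)}{v_k(\xi)}\Big)N(d\xi,ds)\Big),\quad k\in\mathcal I,$$ $$X^*_t=x+\Big[c-(1+\eta)\int_{\mathbb R_+}\xi\,\nu_C(d\xi)\Big]t+\frac1\theta\sum_{k\in\mathcal I}\pi_k\,\ell_k(T)\big[1-\ell_k(-t)\,Z^*_{k,t}\big].$$ -/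

import Mathlib

open MeasureTheory ProbabilityTheory Set Filter Topology

noncomputable section

/-- The index set of the models: `none` is the counterparty `C`, and `some i` are the `n` other
models. -/
abbrev ModelIndex (n : ℕ) : Type := Option (Fin n)

/-- A point measure: a countable sum of unit point masses. -/
def IsPointMeasure {E : Type*} [MeasurableSpace E] (m : Measure E) : Prop :=
  ∃ (I : Set ℕ) (p : ℕ → E), m = Measure.sum fun i : I => Measure.dirac (p i)

/-- Under the probability measure `P`, the random measure `N` on `E` is a Poisson random measure
with intensity (compensator) `μ`: it is a random point measure, `N A` is Poisson distributed with
mean `μ A` when `μ A < ∞`, and the masses of pairwise disjoint sets are independent. -/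
structure IsPoissonRandomMeasure {Ω E : Type*} [MeasurableSpace Ω] [MeasurableSpace E]
    (P : Measure Ω) (N : Ω → Measure E) (μ : Measure E) : Prop where
  measurable : Measurable N
  isPointMeasure : ∀ᵐ ω ∂P, IsPointMeasure (N ω)
  map_eq_poisson : ∀ A : Set E, MeasurableSet A → μ A < ⊤ →
    P.map (fun ω => N ω A)
      = (poissonMeasure (μ A).toNNReal).map (fun j : ℕ => (j : ENNReal))
  indep : ∀ (m : ℕ) (A : Fin m → Set E), (∀ i, MeasurableSet (A i)) →
    Pairwise (fun i j => Disjoint (A i) (A j)) → iIndepFun (fun i ω => N ω (A i)) P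

/-- The measure `ν(dξ) = v(ξ) dξ` on `ℝ₊ = (0, ∞)` (viewed as a measure on `ℝ`). -/
def lossMeasure (v : ℝ → ℝ) : Measure ℝ :=
  (volume.restrict (Ioi 0)).withDensity fun ξ => ENNReal.ofReal (v ξ)

/-- The measure `ν(dξ) dt` on `ℝ₊ × (0, T]`. -/
def lossIntensity (v : ℝ → ℝ) (T : ℝ) : Measure (ℝ × ℝ) :=
  (lossMeasure v).prod (volume.restrict (Ioc 0 T))

/-- The path `f` is right-continuous with left limits on `[0, T]`. -/
def IsCadlagOn (f : ℝ → ℝ) (T : ℝ) : Prop :=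
  (∀ t ∈ Ico 0 T, ContinuousWithinAt f (Ici t) t) ∧
    ∀ t ∈ Ioc 0 T, ∃ l : ℝ, Tendsto f (𝓝[<] t) (𝓝 l)

/-- `∫₀ᵗ ∫_{ℝ₊} H(ξ, s) m(dξ, ds)`, for a measure `m` on pairs (mark, time). -/
def jumpIntegral (m : Measure (ℝ × ℝ)) (H : ℝ × ℝ → ℝ) (t : ℝ) : ℝ :=
  ∫ p in Ioi 0 ×ˢ Ioc 0 t, H p ∂m

/-- `H` is integrable on `ℝ₊ × (0, T]` with respect to `m`. -/
def JumpIntegrable (m : Measure (ℝ × ℝ)) (H : ℝ × ℝ → ℝ) (T : ℝ) : Prop :=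
  IntegrableOn H (Ioi 0 ×ˢ Ioc 0 T) m

/-- The integral `∫₀ᵗ ∫_{ℝ₊} H(ξ, s) Ñ(dξ, ds)` against the compensated measure
`Ñ(dξ, ds) = m(dξ, ds) - v(ξ) dξ ds`, taken path by path. -/
def compensatedIntegral (m : Measure (ℝ × ℝ)) (v : ℝ → ℝ) (H : ℝ × ℝ → ℝ) (t : ℝ) : ℝ :=
  jumpIntegral m H t - ∫ s in Ioc 0 t, ∫ ξ, H (ξ, s) ∂(lossMeasure v)

/-- The integrand `Z_{s-} [1 - β_s(ξ) / v(ξ)]` along a path. -/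
def auxIntegrand (v : ℝ → ℝ) (b : ℝ → ℝ → ℝ) (z : ℝ → ℝ) : ℝ × ℝ → ℝ :=
  fun p => Function.leftLim z p.2 * (1 - b p.2 p.1 / v p.1)

/-- On `[0, T]`, the process `Z` is, under `P`, a solution of
`dZ_t = - Z_{t-} ∫_{ℝ₊} [1 - β_t(ξ) / v(ξ)] Ñ(dξ, dt)`, `Z_0 = 1`,
where `Ñ(dξ, dt) = N(dξ, dt) - v(ξ) dξ dt`. The arguments of the random field `β` are the time,
the mark and the outcome. -/
def IsAuxiliaryProcess {Ω : Type*} [MeasurableSpace Ω] (P : Measure Ω)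
    (N : Ω → Measure (ℝ × ℝ)) (v : ℝ → ℝ) (T : ℝ) (β : ℝ → ℝ → Ω → ℝ) (Z : ℝ → Ω → ℝ) : Prop :=
  ∀ᵐ ω ∂P,
    IsCadlagOn (fun t => Z t ω) T ∧
    JumpIntegrable (N ω) (auxIntegrand v (fun s ξ => β s ξ ω) fun t => Z t ω) T ∧
    Integrable (auxIntegrand v (fun s ξ => β s ξ ω) fun t => Z t ω) (lossIntensity v T) ∧
    ∀ t ∈ Icc 0 T, Z t ω
      = 1 - compensatedIntegral (N ω) v (auxIntegrand v (fun s ξ => β s ξ ω) fun t => Z t ω) t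

/-- On `[0, T]`, the process `X` is, under `P`, the wealth process of an insurer with initial
wealth `x` and premium rate `c` who cedes `α_t(ξ)` to a counterparty with loss density `vC` and
safety loading `η`:
`X_t = x + ∫₀ᵗ [c - (1+η) ∫ α_s(ξ) vC(ξ) dξ] ds - ∫₀ᵗ ∫ [ξ - α_s(ξ)] N(dξ, ds)`.
The arguments of the random field `α` are the time, the mark and the outcome. -/
def IsWealthProcess {Ω : Type*} [MeasurableSpace Ω] (P : Measure Ω)
    (N : Ω → Measure (ℝ × ℝ)) (vC : ℝ → ℝ) (T c η x : ℝ) (α : ℝ → ℝ → Ω → ℝ)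
    (X : ℝ → Ω → ℝ) : Prop :=
  ∀ᵐ ω ∂P,
    IsCadlagOn (fun t => X t ω) T ∧
    JumpIntegrable (N ω) (fun p => p.1 - α p.2 p.1 ω) T ∧
    Integrable (fun p : ℝ × ℝ => α p.2 p.1 ω) (lossIntensity vC T) ∧
    ∀ t ∈ Icc 0 T, X t ω
      = x + (∫ s in Ioc 0 t, (c - (1 + η) * ∫ ξ, α s ξ ω ∂(lossMeasure vC)))
        - jumpIntegral (N ω) (fun p => p.1 - α p.2 p.1 ω) t

/-- `ℓ(t) = exp (t ∫ [1 - (1+η) vC(ξ) / vk(ξ)]² vk(ξ) dξ)`. -/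
def ell (η : ℝ) (vC vk : ℝ → ℝ) (t : ℝ) : ℝ :=
  Real.exp (t * ∫ ξ, (1 - (1 + η) * (vC ξ / vk ξ)) ^ 2 ∂(lossMeasure vk))

/-- The optimal compensator `β*(ξ) = (1+η) v_C(ξ)`. -/
def betaStar {n : ℕ} (η : ℝ) (v : ModelIndex n → ℝ → ℝ) (ξ : ℝ) : ℝ :=
  (1 + η) * v none ξ

/-- The optimal risk sharing strategy in feedback form,
`α*(t, ξ, z) = ξ - θ⁻¹ ∑ₖ πₖ zₖ ℓₖ(T - t) [(1+η) v_C(ξ) / vₖ(ξ) - 1]`. -/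
def alphaStar {n : ℕ} (η θ T : ℝ) (w : ModelIndex n → ℝ) (v : ModelIndex n → ℝ → ℝ)
    (t ξ : ℝ) (z : ModelIndex n → ℝ) : ℝ :=
  ξ - 1 / θ * ∑ k, w k * z k * ell η (v none) (v k) (T - t)
    * ((1 + η) * (v none ξ / v k ξ) - 1)

/-- `(Z*, X*)` are the auxiliary processes and the wealth process under the optimal controls:
`Zₖ` is driven by the compensator `β*`, for each `k`, and `X` is the wealth under the strategy
`α_t(ξ) = α*(t, ξ, Z_{t-})`. -/
def AreOptimalProcesses {Ω : Type*} [MeasurableSpace Ω] {n : ℕ} (P : ModelIndex n → Measure Ω)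
    (N : Ω → Measure (ℝ × ℝ)) (v : ModelIndex n → ℝ → ℝ) (w : ModelIndex n → ℝ)
    (T c η θ x : ℝ) (Z : ModelIndex n → ℝ → Ω → ℝ) (X : ℝ → Ω → ℝ) : Prop :=
  (∀ k, IsAuxiliaryProcess (P k) N (v k) T (fun _ ξ _ => betaStar η v ξ) (Z k)) ∧
  IsWealthProcess (P none) N (v none) T c η x
    (fun t ξ ω => alphaStar η θ T w v t ξ fun k => Function.leftLim (fun s => Z k s ω) t) X

end

noncomputable section

/-! The statement reduces to a deterministic one, path by path. The intensity is finite, so almost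
surely `N` is a finite sum of unit masses at points of `(0, ∞) × (0, T]` with distinct times and
marks where every density is positive (`ae_isRegularSample`). Logarithms are then trivially
integrable, and the equations become linear equations with finitely many jumps.

Write `D k = 1 - (1+η) v_C / v_k`, `a k = ∫ D k dν_k`, `q k = ∫ (D k)² dν_k`. Between jumps `Z k`
grows at rate `a k`; a jump with mark `ξ` multiplies it by `1 - D k ξ`. The only such path starting
at 1 is the exponential `expPath` (`eq_expPath_of_integral_eq`, `expPath_integral_eq`).

For the wealth, the identity `(1+η) ∫ D k dν_C = a k - q k` (`integral_markDefect_counterparty`) is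
decisive. In the feedback, `ℓ_k(T-s) Z_{k,s-}` is `exp (T q k)` times the left limit of an
exponential path of slope `a k - q k`. That path solves the linear equation whose drift rate is
exactly this `ν_C`-integral, so the reinsurance premium and the retained losses combine into the
closed form (`wealth_path_iff`). -/

/-! ### Poisson random measures of finite intensity: finitely many points with distinct times -/

theorem poissonMeasure_two_le (r : NNReal) :
    poissonMeasure r {j : ℕ | 2 ≤ j} ≤ (r : ENNReal) ^ 2 := by
  have hset : {j : ℕ | 2 ≤ j} = ({0, 1} : Set ℕ)ᶜ := by
    ext j
    simp only [mem_ofPred_eq, mem_compl_iff, mem_insert_iff, mem_singleton_iff]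
    omega
  have h01 : ({0, 1} : Set ℕ) = {0} ∪ {1} := rfl
  have hreal : (poissonMeasure r).real {j : ℕ | 2 ≤ j} ≤ (r : ℝ) ^ 2 := by
    rw [hset, measureReal_compl (MeasurableSet.of_discrete), h01,
      measureReal_union (by simp) MeasurableSet.of_discrete,
      poissonMeasure_real_singleton, poissonMeasure_real_singleton]
    -- The probability is `1 - e⁻ʳ (1 + r)`, at most `1 - (1 - r)(1 + r) = r²`.
    have h1 : 1 - (r : ℝ) ≤ Real.exp (-r) := by
      have := Real.add_one_le_exp (-(r : ℝ))
      linarith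
    simp only [probReal_univ, pow_zero, Nat.factorial, pow_one]
    norm_num
    nlinarith [r.2]
  rw [← ENNReal.ofReal_toReal (measure_ne_top (poissonMeasure r) {j : ℕ | 2 ≤ j})]
  refine (ENNReal.ofReal_le_ofReal hreal).trans (le_of_eq ?_)
  rw [ENNReal.ofReal_pow r.coe_nonneg, ENNReal.ofReal_coe_nnreal]

namespace IsPoissonRandomMeasure

variable {Ω E : Type*} [MeasurableSpace Ω] [MeasurableSpace E] {P : Measure Ω}
  {N : Ω → Measure E} {μ : Measure E}

theorem measure_apply_mem (h : IsPoissonRandomMeasure P N μ) {A : Set E} (hA : MeasurableSet A)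
    (hμ : μ A < ⊤) {S : Set ENNReal} (hS : MeasurableSet S) :
    P {ω | N ω A ∈ S} = poissonMeasure (μ A).toNNReal {j : ℕ | (j : ENNReal) ∈ S} := by
  have h1 : Measurable fun ω => N ω A := (Measure.measurable_coe hA).comp h.measurable
  have h2 := congrArg (fun κ : Measure ENNReal => κ S) (h.map_eq_poisson A hA hμ)
  simp only [Measure.map_apply h1 hS, Measure.map_apply (Measurable.of_discrete) hS] at h2
  exact h2

theorem ae_lt_top (h : IsPoissonRandomMeasure P N μ) {A : Set E} (hA : MeasurableSet A)
    (hμ : μ A < ⊤) : ∀ᵐ ω ∂P, N ω A < ⊤ := by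
  have h1 := h.measure_apply_mem hA hμ (measurableSet_singleton ⊤)
  rw [ae_iff]
  simpa using h1

theorem ae_eq_zero (h : IsPoissonRandomMeasure P N μ) {A : Set E} (hA : MeasurableSet A)
    (hμ : μ A = 0) : ∀ᵐ ω ∂P, N ω A = 0 := by
  have h1 := h.measure_apply_mem hA (by simp [hμ]) (measurableSet_singleton 0).compl
  rw [ae_iff]
  have h2 : {j : ℕ | (j : ENNReal) ∈ ({0} : Set ENNReal)ᶜ} = ({0} : Set ℕ)ᶜ := by
    ext j
    simp
  rw [h2, measure_compl MeasurableSet.of_discrete (measure_ne_top _ _), measure_univ,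
    poissonMeasure_singleton, hμ] at h1
  simpa using h1

theorem measure_two_le (h : IsPoissonRandomMeasure P N μ) {A : Set E} (hA : MeasurableSet A)
    (hμ : μ A < ⊤) : P {ω | 2 ≤ N ω A} ≤ μ A ^ 2 := by
  have h1 := h.measure_apply_mem hA hμ (measurableSet_Ici (a := 2))
  have h2 : {j : ℕ | (j : ENNReal) ∈ Ici (2 : ENNReal)} = {j : ℕ | 2 ≤ j} := by
    ext j
    simp
  rw [h2] at h1
  calc P {ω | 2 ≤ N ω A} = _ := h1
    _ ≤ _ := poissonMeasure_two_le _
    _ = μ A ^ 2 := by rw [ENNReal.coe_toNNReal hμ.ne]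

end IsPoissonRandomMeasure

/-- The `j`-th of the `m` equal parts of the interval `(0, T]`. -/
def timeCell (T : ℝ) (m j : ℕ) : Set ℝ := Ioc (j * (T / m)) ((j + 1) * (T / m))

theorem exists_mem_timeCell {T : ℝ} (hT : 0 < T) {m : ℕ} (hm : 0 < m) {t : ℝ}
    (ht : t ∈ Ioc 0 T) : ∃ j < m, t ∈ timeCell T m j := by
  have hm' : (0 : ℝ) < m := by exact_mod_cast hm
  have hd : 0 < T / m := by positivity
  have hpos : 0 < t / (T / m) := div_pos ht.1 hd
  have hceil : 0 < ⌈t / (T / m)⌉₊ := Nat.ceil_pos.2 hpos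
  have hle : ⌈t / (T / m)⌉₊ ≤ m := by
    refine Nat.ceil_le.2 ?_
    rw [div_le_iff₀ hd]
    field_simp
    exact ht.2
  -- Cells are open on the left and closed on the right, so the index is the ceiling minus one, not
  -- the floor.
  obtain ⟨j, hj⟩ : ∃ j, ⌈t / (T / m)⌉₊ = j + 1 := ⟨_, (Nat.sub_add_cancel hceil).symm⟩
  refine ⟨j, by omega, ?_, ?_⟩
  · rw [← lt_div_iff₀ hd]
    exact Nat.lt_ceil.1 (by omega)
  · rw [← div_le_iff₀ hd]
    have := Nat.le_ceil (t / (T / m))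
    rw [hj] at this
    exact_mod_cast this

/-- A cell of length `T/m` holds two or more points with probability at most `(ρ(E) T / m)²`. A
union bound over `m` cells gives `c / m`. The exceptional event lies in the bad event of every
partition, so letting `m` tend to infinity makes it null. -/
theorem IsPoissonRandomMeasure.ae_exists_separating {Ω E : Type*} [MeasurableSpace Ω]
    [MeasurableSpace E] {P : Measure Ω} {N : Ω → Measure (E × ℝ)} {ρ : Measure E}
    [IsFiniteMeasure ρ] {T : ℝ}
    (h : IsPoissonRandomMeasure P N (ρ.prod (volume.restrict (Ioc 0 T)))) :
    ∀ᵐ ω ∂P, ∃ m : ℕ, 0 < m ∧ ∀ j < m, N ω (univ ×ˢ timeCell T m j) < 2 := by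
  set c : ENNReal := (ρ univ * ENNReal.ofReal T) ^ 2 with hc
  have hctop : c ≠ ⊤ := ENNReal.pow_ne_top (ENNReal.mul_ne_top (measure_ne_top _ _)
    ENNReal.ofReal_ne_top)
  have hbound : ∀ m : ℕ, 0 < m →
      P {ω | ¬ ∃ m : ℕ, 0 < m ∧ ∀ j < m, N ω (univ ×ˢ timeCell T m j) < 2} ≤ c / m := by
    intro m hm
    have hm0 : (m : ENNReal) ≠ 0 := by exact_mod_cast hm.ne'
    have hcell : ∀ j, (ρ.prod (volume.restrict (Ioc 0 T))) (univ ×ˢ timeCell T m j)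
        ≤ ρ univ * ENNReal.ofReal T / m := by
      intro j
      rw [Measure.prod_prod, mul_div_assoc]
      gcongr
      refine (Measure.restrict_apply_le _ _).trans ?_
      rw [timeCell, Real.volume_Ioc, show ((j : ℝ) + 1) * (T / m) - j * (T / m) = T / m by ring,
        ENNReal.ofReal_div_of_pos (by exact_mod_cast hm), ENNReal.ofReal_natCast]
    have hsub : {ω | ¬ ∃ m : ℕ, 0 < m ∧ ∀ j < m, N ω (univ ×ˢ timeCell T m j) < 2}
        ⊆ ⋃ j ∈ Finset.range m, {ω | 2 ≤ N ω (univ ×ˢ timeCell T m j)} := by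
      intro ω hω
      simp only [mem_ofPred_eq, not_exists, not_and, not_forall, not_lt] at hω
      obtain ⟨j, hj, hj2⟩ := hω m hm
      exact mem_biUnion (Finset.mem_coe.2 (Finset.mem_range.2 hj)) hj2
    calc _ ≤ _ := measure_mono hsub
      _ ≤ ∑ j ∈ Finset.range m, P {ω | 2 ≤ N ω (univ ×ˢ timeCell T m j)} :=
        measure_biUnion_finset_le _ _
      _ ≤ ∑ j ∈ Finset.range m, (ρ univ * ENNReal.ofReal T / m) ^ 2 := by
        refine Finset.sum_le_sum fun j _ => ?_
        refine (h.measure_two_le (MeasurableSet.univ.prod measurableSet_Ioc)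
          ((hcell j).trans_lt ?_)).trans (pow_le_pow_left' (hcell j) 2)
        exact ENNReal.div_lt_top (ENNReal.mul_ne_top (measure_ne_top _ _)
          ENNReal.ofReal_ne_top) hm0
      _ = c / m := by
        rw [Finset.sum_const, Finset.card_range, nsmul_eq_mul, hc, div_eq_mul_inv, mul_pow,
          div_eq_mul_inv, sq (m : ENNReal)⁻¹, mul_left_comm, ← mul_assoc (m : ENNReal),
          ENNReal.mul_inv_cancel hm0 (ENNReal.natCast_ne_top m), one_mul]
  rw [ae_iff]
  refine le_antisymm (ge_of_tendsto (x := atTop) (f := fun m : ℕ => c / m) ?_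
    ((eventually_gt_atTop 0).mono hbound)) zero_le
  simpa using ENNReal.Tendsto.const_div ENNReal.tendsto_nat_nhds_top (Or.inr hctop)

/-- Each atom contributes mass one, so finite total mass makes the index set finite. Two atoms with
the same time would share a cell and give it mass at least 2; this rules out repeated points as
well. -/
theorem IsPointMeasure.exists_finset {T : ℝ} (hT : 0 < T) {m : Measure (ℝ × ℝ)}
    (hm : IsPointMeasure m) (hfin : m univ < ⊤) {G : Set (ℝ × ℝ)} (hG : m Gᶜ = 0)
    (hGT : ∀ p ∈ G, p.2 ∈ Ioc 0 T)
    (hsep : ∃ r : ℕ, 0 < r ∧ ∀ j < r, m (univ ×ˢ timeCell T r j) < 2) :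
    ∃ S : Finset (ℝ × ℝ), (S : Set (ℝ × ℝ)) ⊆ G ∧ InjOn Prod.snd (S : Set (ℝ × ℝ)) ∧
      m = ∑ p ∈ S, Measure.dirac p := by
  classical
  obtain ⟨I, p, rfl⟩ := hm
  have hIfin : Finite I := by
    rw [Measure.sum_apply _ MeasurableSet.univ] at hfin
    simp only [measure_univ] at hfin
    by_contra hinf
    rw [not_finite_iff_infinite] at hinf
    rw [ENNReal.tsum_const_eq_top_of_ne_zero one_ne_zero] at hfin
    exact lt_irrefl _ hfin
  have := Fintype.ofFinite I
  have hpG : ∀ i : I, p i ∈ G := by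
    intro i
    have h0 := (Measure.sum_apply_eq_zero.1 hG) i
    by_contra hi
    rw [Measure.dirac_apply, indicator_of_mem (show p i ∈ Gᶜ from hi)] at h0
    exact one_ne_zero h0
  have hinj : ∀ i j : I, (p i).2 = (p j).2 → i = j := by
    intro i j hij
    by_contra hne
    obtain ⟨r, hr, hsep⟩ := hsep
    obtain ⟨l, hl, hmem⟩ := exists_mem_timeCell hT hr (hGT _ (hpG i))
    refine (hsep l hl).not_ge ?_
    rw [Measure.sum_fintype, Measure.finsetSum_apply]
    calc (2 : ENNReal)
        = ∑ k ∈ {i, j}, Measure.dirac (p (k : I)) (univ ×ˢ timeCell T r l) := by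
          rw [Finset.sum_pair hne, Measure.dirac_apply, Measure.dirac_apply,
            indicator_of_mem (by exact ⟨mem_univ _, hmem⟩),
            indicator_of_mem (by exact ⟨mem_univ _, hij ▸ hmem⟩)]
          norm_num
      _ ≤ _ := Finset.sum_le_sum_of_subset (Finset.subset_univ _)
  refine ⟨Finset.univ.image fun i : I => p i, ?_, ?_, ?_⟩
  · intro q hq
    simp only [Finset.coe_image, Finset.coe_univ, image_univ, mem_range] at hq
    obtain ⟨i, rfl⟩ := hq
    exact hpG i
  · intro q hq q' hq' h
    simp only [Finset.coe_image, Finset.coe_univ, image_univ, mem_range] at hq hq'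
    obtain ⟨i, rfl⟩ := hq
    obtain ⟨j, rfl⟩ := hq'
    rw [hinj i j h]
  · rw [Measure.sum_fintype, Finset.sum_image]
    intro i _ j _ h
    exact hinj i j (congrArg Prod.snd h)

/-! ### One-sided calculus for càdlàg paths -/

section Calculus

/-- Right differentiability gives right continuity, so with left continuity `f` is continuous and
the mean value theorem for right derivatives applies. Uniqueness uses it on a quotient, existence on
a difference. -/
theorem eq_of_hasDerivWithinAt_zero_of_tendsto_left {f : ℝ → ℝ} {T : ℝ}
    (hright : ∀ t ∈ Ico 0 T, HasDerivWithinAt f 0 (Ici t) t)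
    (hleft : ∀ t ∈ Ioc 0 T, Tendsto f (𝓝[<] t) (𝓝 (f t))) :
    ∀ t ∈ Icc 0 T, f t = f 0 := by
  refine constant_of_has_deriv_right_zero (fun t ht => ?_) hright
  have hsub : Icc 0 T ⊆ (Icc 0 T ∩ Iio t) ∪ (Icc 0 T ∩ Ici t) := fun u hu =>
    (lt_or_ge u t).imp (fun h => ⟨hu, h⟩) fun h => ⟨hu, h⟩
  refine ContinuousWithinAt.mono (ContinuousWithinAt.union ?_ ?_) hsub
  · rcases ht.1.eq_or_lt with h0 | h0
    · have : Icc 0 T ∩ Iio t = ∅ := by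
        ext u
        simp only [mem_inter_iff, mem_Icc, mem_Iio, mem_empty_iff_false, iff_false]
        rintro ⟨⟨h1, -⟩, h2⟩
        linarith
      rw [this]
      exact continuousWithinAt_of_notMem_closure (by simp)
    · have h1 : ContinuousWithinAt f (Iio t) t := hleft t ⟨h0, ht.2⟩
      exact h1.mono inter_subset_right
  · rcases ht.2.eq_or_lt with hT | hT
    · refine (continuousWithinAt_singleton (f := f) (x := t)).mono ?_
      rintro u ⟨⟨-, h1⟩, h2⟩
      exact le_antisymm (hT ▸ h1) h2
    · exact (hright t ⟨ht.1, hT⟩).continuousWithinAt.mono inter_subset_right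

/-- Only a right limit of the integrand is needed, so this also applies at jump times. -/
theorem hasDerivWithinAt_setIntegral_Ioc {y : ℝ → ℝ} {T c t : ℝ}
    (hy : IntegrableOn y (Ioc 0 T)) (ht : t ∈ Ico 0 T) (hc : Tendsto y (𝓝[>] t) (𝓝 c)) :
    HasDerivWithinAt (fun u => ∫ s in Ioc 0 u, y s) c (Ici t) t := by
  have h1 : HasDerivWithinAt (fun u => ∫ s in (0 : ℝ)..u, y s) c (Ici t) t := by
    refine intervalIntegral.integral_hasDerivWithinAt_of_tendsto_ae_right
      ((intervalIntegrable_iff_integrableOn_Ioc_of_le ht.1).2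
        (hy.mono_set (Ioc_subset_Ioc_right ht.2.le))) (t := Ioi t) ?_ (hc.mono_left inf_le_left)
    refine ⟨Ioc t T, Ioc_mem_nhdsGT ht.2, ?_⟩
    exact (hy.mono_set (Ioc_subset_Ioc_left ht.1)).aestronglyMeasurable
  refine h1.congr (fun u hu => ?_) ?_
  · rw [intervalIntegral.integral_of_le (ht.1.trans hu)]
  · rw [intervalIntegral.integral_of_le ht.1]

theorem tendsto_setIntegral_Ioc_left {y : ℝ → ℝ} {T t : ℝ}
    (hy : IntegrableOn y (Ioc 0 T)) (ht : t ∈ Ioc 0 T) :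
    Tendsto (fun u => ∫ s in Ioc 0 u, y s) (𝓝[<] t) (𝓝 (∫ s in Ioc 0 t, y s)) := by
  have h1 := intervalIntegral.continuousOn_primitive
    ((integrableOn_Icc_iff_integrableOn_Ioc (by simp)).2 hy) t (Ioc_subset_Icc_self ht)
  rw [← nhdsWithin_Ioo_eq_nhdsLT ht.1]
  exact h1.mono fun u hu => ⟨hu.1.le, hu.2.le.trans ht.2⟩

/-- For `s` just after `t`, the left limit at `s` is a limit of values taken in `(t, s)`, which lie
in a closed neighbourhood of `z t`. Thus a drift driven by `z_{s-}` has right derivative governed by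
`z t`. -/
theorem tendsto_leftLim_right {z : ℝ → ℝ} {T t : ℝ} (hz : IsCadlagOn z T) (ht : t ∈ Ico 0 T) :
    Tendsto (Function.leftLim z) (𝓝[>] t) (𝓝 (z t)) := by
  refine (closed_nhds_basis (z t)).tendsto_right_iff.2 ?_
  rintro V ⟨hV, hVc⟩
  have h1 : ∀ᶠ u in 𝓝[>] t, z u ∈ V :=
    (hz.1 t ht).mono_left (nhdsWithin_mono _ Ioi_subset_Ici_self) hV
  obtain ⟨δ, hδ, hsub⟩ := (mem_nhdsGT_iff_exists_Ioo_subset' ht.2).1 h1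
  filter_upwards [Ioo_mem_nhdsGT (lt_min hδ ht.2)] with s hs
  obtain ⟨l, hl⟩ := hz.2 s ⟨ht.1.trans_lt hs.1, (hs.2.trans_le (min_le_right _ _)).le⟩
  rw [leftLim_eq_of_tendsto hl]
  refine hVc.mem_of_tendsto hl ?_
  filter_upwards [Ioo_mem_nhdsLT hs.1] with u hu
  exact hsub ⟨hu.1, hu.2.trans (hs.2.trans_le (min_le_left _ _))⟩

theorem IsCadlagOn.congr {f g : ℝ → ℝ} {T : ℝ} (hf : IsCadlagOn f T)
    (h : ∀ t ∈ Icc 0 T, g t = f t) : IsCadlagOn g T := by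
  refine ⟨fun t ht => ?_, fun t ht => ?_⟩
  · refine (hf.1 t ht).congr_of_eventuallyEq ?_ (h t ⟨ht.1, ht.2.le⟩)
    filter_upwards [Icc_mem_nhdsGE ht.2] with u hu
    exact h u ⟨ht.1.trans hu.1, hu.2⟩
  · obtain ⟨l, hl⟩ := hf.2 t ht
    refine ⟨l, hl.congr' ?_⟩
    filter_upwards [Ioo_mem_nhdsLT ht.1] with u hu
    exact (h u ⟨hu.1.le, hu.2.le.trans ht.2⟩).symm

end Calculus

/-! ### Sums over finitely many jump times -/

section JumpSum

variable {ι : Type*} (S : Finset ι) (τ : ι → ℝ) (c : ι → ℝ)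

/-- The sum of the jumps `c i` whose time `τ i` is at most `t`. -/
def jumpSum (t : ℝ) : ℝ := ∑ i ∈ S with τ i ≤ t, c i

/-- The sum of the jumps `c i` whose time `τ i` is before `t`. -/
def jumpSumLeft (t : ℝ) : ℝ := ∑ i ∈ S with τ i < t, c i

/-- The sum of the jumps `c i` at time `t`. -/
def jumpAt (t : ℝ) : ℝ := ∑ i ∈ S with τ i = t, c i

theorem jumpSum_eq_add (t : ℝ) : jumpSum S τ c t = jumpSumLeft S τ c t + jumpAt S τ c t := by
  classical
  rw [jumpSum, jumpSumLeft, jumpAt, ← Finset.sum_union]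
  · congr 1
    ext i
    simp only [Finset.mem_filter, Finset.mem_union, le_iff_lt_or_eq]
    tauto
  · rw [Finset.disjoint_filter]
    exact fun i _ h => h.ne

theorem eventually_jumpSum_right (t : ℝ) :
    ∀ᶠ u in 𝓝[≥] t, jumpSum S τ c u = jumpSum S τ c t := by
  have h : ∀ i ∈ S, ∀ᶠ u in 𝓝[≥] t, (τ i ≤ u ↔ τ i ≤ t) := by
    intro i _
    rcases le_or_gt (τ i) t with hi | hi
    · filter_upwards [self_mem_nhdsWithin] with u hu
      exact iff_of_true (hi.trans hu) hi
    · filter_upwards [mem_nhdsWithin_of_mem_nhds (Iio_mem_nhds hi)] with u hu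
      exact iff_of_false (not_le.2 hu) (not_le.2 hi)
  filter_upwards [(Filter.eventually_all_finset S).2 h] with u hu
  rw [jumpSum, jumpSum, Finset.filter_congr hu]

theorem eventually_jumpSum_left (t : ℝ) :
    ∀ᶠ u in 𝓝[<] t, jumpSum S τ c u = jumpSumLeft S τ c t := by
  have h : ∀ i ∈ S, ∀ᶠ u in 𝓝[<] t, (τ i ≤ u ↔ τ i < t) := by
    intro i _
    rcases lt_or_ge (τ i) t with hi | hi
    · filter_upwards [mem_nhdsWithin_of_mem_nhds (Ioi_mem_nhds hi)] with u hu
      exact iff_of_true (le_of_lt hu) hi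
    · filter_upwards [self_mem_nhdsWithin] with u hu
      exact iff_of_false (not_le.2 (lt_of_lt_of_le hu hi)) (not_lt.2 hi)
  filter_upwards [(Filter.eventually_all_finset S).2 h] with u hu
  rw [jumpSum, jumpSumLeft, Finset.filter_congr hu]

variable {S τ}

theorem jumpSum_zero (hτ : ∀ i ∈ S, 0 < τ i) : jumpSum S τ c 0 = 0 := by
  rw [jumpSum, Finset.filter_false_of_mem (fun i hi => not_le.2 (hτ i hi)), Finset.sum_empty]

theorem jumpAt_eq_zero_or (hinj : InjOn τ S) (t : ℝ) :
    (∀ c : ι → ℝ, jumpAt S τ c t = 0) ∨ ∃ i ∈ S, τ i = t ∧ ∀ c : ι → ℝ, jumpAt S τ c t = c i := by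
  by_cases h : ∃ i ∈ S, τ i = t
  · obtain ⟨i, hi, rfl⟩ := h
    refine Or.inr ⟨i, hi, rfl, fun c => ?_⟩
    have : S.filter (fun j => τ j = τ i) = {i} := by
      ext j
      simp only [Finset.mem_filter, Finset.mem_singleton]
      exact ⟨fun hj => hinj hj.1 hi hj.2, fun hj => ⟨hj ▸ hi, hj ▸ rfl⟩⟩
    rw [jumpAt, this, Finset.sum_singleton]
  · push Not at h
    exact Or.inl fun c => by rw [jumpAt, Finset.filter_false_of_mem h, Finset.sum_empty]

/-- With distinct times at most one jump occurs at `t`, so the additive and multiplicative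
descriptions agree. Simultaneous jumps would leave cross terms in the product. -/
theorem one_sub_jumpAt (hinj : InjOn τ S) {g L : ι → ℝ} (hL : ∀ i ∈ S, Real.exp (L i) = 1 - g i)
    (t : ℝ) : 1 - jumpAt S τ g t = Real.exp (jumpAt S τ L t) := by
  rcases jumpAt_eq_zero_or hinj t with h | ⟨i, hi, -, h⟩
  · simp [h]
  · rw [h, h, hL i hi]

theorem jumpAt_comp_mul (f : ℝ → ℝ) (g : ι → ℝ) (t : ℝ) :
    jumpAt S τ (fun i => f (τ i) * g i) t = f t * jumpAt S τ g t := by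
  rw [jumpAt, jumpAt, Finset.mul_sum]
  exact Finset.sum_congr rfl fun i hi => by rw [(Finset.mem_filter.1 hi).2]

theorem measurable_jumpSumLeft : Measurable (jumpSumLeft S τ c) := by
  have : jumpSumLeft S τ c = fun t => ∑ i ∈ S, (Ioi (τ i)).indicator (fun _ => c i) t := by
    funext t
    rw [jumpSumLeft, Finset.sum_filter]
    exact Finset.sum_congr rfl fun i _ => by simp [indicator_apply]
  rw [this]
  exact Finset.measurable_sum _ fun i _ => measurable_const.indicator measurableSet_Ioi

theorem jumpSumLeft_le (t : ℝ) : jumpSumLeft S τ c t ≤ ∑ i ∈ S, |c i| :=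
  (Finset.sum_le_sum fun i _ => le_abs_self (c i)).trans
    (Finset.sum_le_sum_of_subset_of_nonneg (Finset.filter_subset _ _) fun _ _ _ => abs_nonneg _)

end JumpSum

/-! ### Linear equations with finitely many jumps -/

section ExpPath

variable {ι : Type*} (a : ℝ) (S : Finset ι) (τ : ι → ℝ) (L : ι → ℝ)

/-- The exponential of a path with slope `a` and jumps `L i` at times `τ i`. -/
def expPath (t : ℝ) : ℝ := Real.exp (a * t + jumpSum S τ L t)

/-- The left limits of `expPath`. -/
def expPathLeft (t : ℝ) : ℝ := Real.exp (a * t + jumpSumLeft S τ L t)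

theorem expPath_eq_mul (t : ℝ) :
    expPath a S τ L t = expPathLeft a S τ L t * Real.exp (jumpAt S τ L t) := by
  rw [expPath, expPathLeft, jumpSum_eq_add, ← Real.exp_add, add_assoc]

theorem hasDerivWithinAt_expPath (t : ℝ) :
    HasDerivWithinAt (expPath a S τ L) (a * expPath a S τ L t) (Ici t) t := by
  have h1 : HasDerivAt (fun u => Real.exp (a * u + jumpSum S τ L t))
      (Real.exp (a * t + jumpSum S τ L t) * (a * 1)) t :=
    (((hasDerivAt_id t).const_mul a).add_const _).exp
  rw [mul_one, mul_comm] at h1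
  refine h1.hasDerivWithinAt.congr_of_eventuallyEq ?_ rfl
  filter_upwards [eventually_jumpSum_right S τ L t] with u hu
  rw [expPath, hu]

theorem tendsto_expPath_left (t : ℝ) :
    Tendsto (expPath a S τ L) (𝓝[<] t) (𝓝 (expPathLeft a S τ L t)) := by
  have h1 : Tendsto (fun u => Real.exp (a * u + jumpSumLeft S τ L t)) (𝓝[<] t)
      (𝓝 (expPathLeft a S τ L t)) :=
    Continuous.tendsto' (by fun_prop) _ _ rfl |>.mono_left nhdsWithin_le_nhds
  refine h1.congr' ?_
  filter_upwards [eventually_jumpSum_left S τ L t] with u hu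
  rw [expPath, hu]

theorem isCadlagOn_expPath (T : ℝ) : IsCadlagOn (expPath a S τ L) T :=
  ⟨fun t _ => (hasDerivWithinAt_expPath a S τ L t).continuousWithinAt,
    fun t _ => ⟨_, tendsto_expPath_left a S τ L t⟩⟩

theorem leftLim_expPath (t : ℝ) :
    Function.leftLim (expPath a S τ L) t = expPathLeft a S τ L t :=
  leftLim_eq_of_tendsto (tendsto_expPath_left a S τ L t)

theorem leftLim_eq_expPathLeft {z : ℝ → ℝ} {T t : ℝ}
    (hz : ∀ t ∈ Icc 0 T, z t = expPath a S τ L t) (ht : t ∈ Ioc 0 T) :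
    Function.leftLim z t = expPathLeft a S τ L t := by
  refine leftLim_eq_of_tendsto ((tendsto_expPath_left a S τ L t).congr' ?_)
  filter_upwards [Ioo_mem_nhdsLT ht.1] with u hu
  exact (hz u ⟨hu.1.le, hu.2.le.trans ht.2⟩).symm

theorem integrableOn_expPathLeft (T : ℝ) : IntegrableOn (expPathLeft a S τ L) (Ioc 0 T) := by
  have hmeas : Measurable (expPathLeft a S τ L) :=
    ((measurable_const.mul measurable_id).add (measurable_jumpSumLeft L)).exp
  refine Measure.integrableOn_of_bounded (M := Real.exp (|a| * T + ∑ i ∈ S, |L i|)) (by simp)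
    hmeas.aestronglyMeasurable ?_
  refine (ae_restrict_iff' measurableSet_Ioc).2 (ae_of_all _ fun t ht => ?_)
  rw [Real.norm_eq_abs, expPathLeft, abs_of_pos (Real.exp_pos _), Real.exp_le_exp]
  refine add_le_add ?_ (jumpSumLeft_le L t)
  calc a * t ≤ |a| * t := mul_le_mul_of_nonneg_right (le_abs_self a) ht.1.le
    _ ≤ |a| * T := mul_le_mul_of_nonneg_left ht.2 (abs_nonneg a)

variable {a S τ L}

theorem expPath_zero (hτ : ∀ i ∈ S, 0 < τ i) : expPath a S τ L 0 = 1 := by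
  simp [expPath, jumpSum_zero L hτ]

/-- Serves to absorb the time-dependent part of `ℓ_k(T - t)` into the slope, with `b = -q k`. -/
theorem expPathLeft_eq_mul (b t : ℝ) :
    expPathLeft (a + b) S τ L t = Real.exp (b * t) * expPathLeft a S τ L t := by
  rw [expPathLeft, expPathLeft, ← Real.exp_add]
  ring_nf

theorem expPath_eq_mul_exp (b t : ℝ) :
    expPath (a + b) S τ L t = Real.exp (b * t) * expPath a S τ L t := by
  rw [expPath, expPath, ← Real.exp_add]
  ring_nf

/-- The quotient of `z` by the exponential path has zero right derivative, and at a jump both are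
multiplied by the same factor, so the quotient is left-continuous and stays equal to 1. -/
theorem eq_expPath_of_hasDerivWithinAt {z : ℝ → ℝ} {T : ℝ} (hτ : ∀ i ∈ S, 0 < τ i)
    (h0 : z 0 = 1) (hright : ∀ t ∈ Ico 0 T, HasDerivWithinAt z (a * z t) (Ici t) t)
    (hleft : ∀ t ∈ Ioc 0 T, ∃ l, Tendsto z (𝓝[<] t) (𝓝 l) ∧
      z t = l * Real.exp (jumpAt S τ L t)) :
    ∀ t ∈ Icc 0 T, z t = expPath a S τ L t := by
  have hE : ∀ t, expPath a S τ L t ≠ 0 := fun t => (Real.exp_pos _).ne'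
  have key : ∀ t ∈ Icc 0 T, z t / expPath a S τ L t = z 0 / expPath a S τ L 0 := by
    refine eq_of_hasDerivWithinAt_zero_of_tendsto_left (fun t ht => ?_) (fun t ht => ?_)
    · refine ((hright t ht).div (hasDerivWithinAt_expPath a S τ L t) (hE t)).congr_deriv ?_
      rw [div_eq_zero_iff]
      exact Or.inl (by ring)
    · obtain ⟨l, hl, hzt⟩ := hleft t ht
      rw [hzt, expPath_eq_mul, mul_div_mul_right _ _ (Real.exp_pos _).ne']
      exact hl.div (tendsto_expPath_left a S τ L t) (Real.exp_pos _).ne'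
  intro t ht
  have h := key t ht
  rwa [h0, expPath_zero hτ, div_one, div_eq_one_iff_eq (hE t)] at h

/-- Uniqueness for the linear equation with finitely many jumps. -/
theorem eq_expPath_of_integral_eq {z : ℝ → ℝ} {T : ℝ} {g : ι → ℝ} (hT : 0 ≤ T)
    (hτ : ∀ i ∈ S, 0 < τ i) (hinj : InjOn τ S) (hL : ∀ i ∈ S, Real.exp (L i) = 1 - g i)
    (hz : IsCadlagOn z T) (hint : IntegrableOn (fun s => a * Function.leftLim z s) (Ioc 0 T))
    (heq : ∀ t ∈ Icc 0 T, z t = 1 + (∫ s in Ioc 0 t, a * Function.leftLim z s)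
      - jumpSum S τ (fun i => Function.leftLim z (τ i) * g i) t) :
    ∀ t ∈ Icc 0 T, z t = expPath a S τ L t := by
  refine eq_expPath_of_hasDerivWithinAt hτ ?_ (fun t ht => ?_) (fun t ht => ?_)
  · rw [heq 0 ⟨le_rfl, hT⟩, jumpSum_zero _ hτ]
    simp
  · have h1 := hasDerivWithinAt_setIntegral_Ioc hint ht ((tendsto_leftLim_right hz ht).const_mul a)
    refine ((h1.const_add 1).sub_const (jumpSum S τ (fun i => Function.leftLim z (τ i) * g i)
      t)).congr_of_eventuallyEq ?_ (heq t ⟨ht.1, ht.2.le⟩)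
    filter_upwards [Icc_mem_nhdsGE ht.2,
      eventually_jumpSum_right S τ (fun i => Function.leftLim z (τ i) * g i) t] with u hu hu'
    rw [heq u ⟨ht.1.trans hu.1, hu.2⟩, hu']
  · obtain ⟨l, hl⟩ := hz.2 t ht
    refine ⟨l, hl, ?_⟩
    have h2 : Tendsto z (𝓝[<] t) (𝓝 (1 + (∫ s in Ioc 0 t, a * Function.leftLim z s)
        - jumpSumLeft S τ (fun i => Function.leftLim z (τ i) * g i) t)) := by
      refine (((tendsto_setIntegral_Ioc_left hint ht).const_add 1).sub_const _).congr' ?_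
      filter_upwards [Ioo_mem_nhdsLT ht.1,
        eventually_jumpSum_left S τ (fun i => Function.leftLim z (τ i) * g i) t] with u hu hu'
      rw [heq u ⟨hu.1.le, hu.2.le.trans ht.2⟩, hu']
    -- Comparing the left limit with the equation at `t` isolates the jump: `z t = l * (1 - jumpAt S
    -- τ g t)`.
    have h3 := tendsto_nhds_unique hl h2
    have h4 := heq t (Ioc_subset_Icc_self ht)
    rw [jumpSum_eq_add, jumpAt_comp_mul (Function.leftLim z), leftLim_eq_of_tendsto hl] at h4
    rw [← one_sub_jumpAt hinj hL]
    linarith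

/-- Existence for the linear equation with finitely many jumps. -/
theorem expPath_integral_eq {g : ι → ℝ} (hτ : ∀ i ∈ S, 0 < τ i) (hinj : InjOn τ S)
    (hL : ∀ i ∈ S, Real.exp (L i) = 1 - g i) {t : ℝ} (ht : 0 ≤ t) :
    expPath a S τ L t = 1 + (∫ s in Ioc 0 t, a * expPathLeft a S τ L s)
      - jumpSum S τ (fun i => expPathLeft a S τ L (τ i) * g i) t := by
  set c : ι → ℝ := fun i => expPathLeft a S τ L (τ i) * g i
  have hint : IntegrableOn (fun s => a * expPathLeft a S τ L s) (Ioc 0 t) :=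
    (integrableOn_expPathLeft a S τ L t).const_mul a
  -- The difference of the two sides has zero right derivative, no jumps, and value 0 at time 0.
  have key := eq_of_hasDerivWithinAt_zero_of_tendsto_left (T := t)
    (f := fun t => expPath a S τ L t
      - (1 + (∫ s in Ioc 0 t, a * expPathLeft a S τ L s) - jumpSum S τ c t))
    (fun u hu => ?_) (fun u hu => ?_) t ⟨ht, le_rfl⟩
  · simp only [expPath_zero hτ, jumpSum_zero c hτ, Ioc_self, Measure.restrict_empty,
      integral_zero_measure] at key
    linarith
  · have h0 := (tendsto_leftLim_right (isCadlagOn_expPath a S τ L t) hu).const_mul a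
    simp only [leftLim_expPath] at h0
    have h1 := hasDerivWithinAt_setIntegral_Ioc hint hu h0
    have h2 := (hasDerivWithinAt_expPath a S τ L u).sub
      ((h1.const_add 1).sub_const (jumpSum S τ c u))
    rw [sub_self] at h2
    refine h2.congr_of_eventuallyEq ?_ rfl
    filter_upwards [eventually_jumpSum_right S τ c u] with r hr
    simp [hr]
  · have h1 := ((tendsto_setIntegral_Ioc_left hint hu).const_add 1).sub_const
      (jumpSumLeft S τ c u)
    have h2 := (tendsto_expPath_left a S τ L u).sub h1
    have h3 : jumpAt S τ c u = expPathLeft a S τ L u * jumpAt S τ g u :=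
      jumpAt_comp_mul (expPathLeft a S τ L) g u
    convert h2.congr' ?_ using 2
    · rw [expPath_eq_mul, jumpSum_eq_add, h3, ← one_sub_jumpAt hinj hL]
      ring
    · filter_upwards [eventually_jumpSum_left S τ c u] with r hr
      rw [hr]

end ExpPath

/-! ### Integrals of the relative defect under the loss measures -/

section LossMeasure

variable {v : ℝ → ℝ}

theorem ae_lossMeasure {p : ℝ → Prop} (h : ∀ᵐ ξ ∂(volume.restrict (Ioi (0 : ℝ))), p ξ) :
    ∀ᵐ ξ ∂(lossMeasure v), p ξ :=
  (withDensity_absolutelyContinuous _ _).ae_le h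

theorem integrable_lossMeasure_iff (hv : Measurable v)
    (hpos : ∀ᵐ ξ ∂(volume.restrict (Ioi (0 : ℝ))), 0 < v ξ) (f : ℝ → ℝ) :
    Integrable f (lossMeasure v) ↔ IntegrableOn (fun ξ => v ξ * f ξ) (Ioi 0) := by
  rw [lossMeasure, integrable_withDensity_iff_integrable_smul' hv.ennreal_ofReal (by simp)]
  refine integrable_congr ?_
  filter_upwards [hpos] with ξ hξ
  rw [ENNReal.toReal_ofReal hξ.le, smul_eq_mul]

theorem integral_lossMeasure (hv : Measurable v)
    (hpos : ∀ᵐ ξ ∂(volume.restrict (Ioi (0 : ℝ))), 0 < v ξ) (f : ℝ → ℝ) :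
    ∫ ξ, f ξ ∂(lossMeasure v) = ∫ ξ in Ioi 0, v ξ * f ξ := by
  rw [lossMeasure, integral_withDensity_eq_integral_toReal_smul hv.ennreal_ofReal (by simp)]
  refine integral_congr_ae ?_
  filter_upwards [hpos] with ξ hξ
  rw [ENNReal.toReal_ofReal hξ.le, smul_eq_mul]

theorem isFiniteMeasure_lossMeasure (hint : IntegrableOn v (Ioi 0)) :
    IsFiniteMeasure (lossMeasure v) :=
  isFiniteMeasure_withDensity_ofReal hint.2

/-- The relative defect `1 - (1+η) vC(ξ) / v(ξ)`. -/
def markDefect (η : ℝ) (vC v : ℝ → ℝ) (ξ : ℝ) : ℝ := 1 - (1 + η) * (vC ξ / v ξ)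

variable {vC : ℝ → ℝ} (η : ℝ)

theorem integrable_markDefect (hv : Measurable v)
    (hpos : ∀ᵐ ξ ∂(volume.restrict (Ioi (0 : ℝ))), 0 < v ξ)
    (hint : IntegrableOn v (Ioi 0)) (hintC : IntegrableOn vC (Ioi 0)) :
    Integrable (markDefect η vC v) (lossMeasure v) := by
  rw [integrable_lossMeasure_iff hv hpos]
  refine (hint.sub (hintC.const_mul (1 + η))).congr ?_
  filter_upwards [hpos] with ξ hξ
  simp only [Pi.sub_apply, markDefect]
  field_simp

theorem integral_markDefect (hv : Measurable v)
    (hpos : ∀ᵐ ξ ∂(volume.restrict (Ioi (0 : ℝ))), 0 < v ξ) :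
    ∫ ξ, markDefect η vC v ξ ∂(lossMeasure v) = ∫ ξ in Ioi 0, (v ξ - (1 + η) * vC ξ) := by
  rw [integral_lossMeasure hv hpos]
  refine integral_congr_ae ?_
  filter_upwards [hpos] with ξ hξ
  simp only [markDefect]
  field_simp

/-- The density of the integrand is `v_C - (1+η) v_C² / v`; this is where the square-ratio
assumption enters. -/
theorem integrable_markDefect_counterparty
    (hpos : ∀ᵐ ξ ∂(volume.restrict (Ioi (0 : ℝ))), 0 < v ξ)
    (hvC : Measurable vC) (hposC : ∀ᵐ ξ ∂(volume.restrict (Ioi (0 : ℝ))), 0 < vC ξ)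
    (hintC : IntegrableOn vC (Ioi 0)) (hratio : IntegrableOn (fun ξ => vC ξ ^ 2 / v ξ) (Ioi 0)) :
    Integrable (markDefect η vC v) (lossMeasure vC) := by
  rw [integrable_lossMeasure_iff hvC hposC]
  refine (hintC.sub (hratio.const_mul (1 + η))).congr ?_
  filter_upwards [hpos] with ξ hξ
  simp only [Pi.sub_apply, markDefect]
  field_simp

/-- Since `(1+η) v_C = v (1 - D)` wherever `v > 0`, one has `(1+η) v_C D = v D - v D²`. The last
term is the exponent rate of `ell`. -/
theorem integral_markDefect_counterparty (hv : Measurable v)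
    (hpos : ∀ᵐ ξ ∂(volume.restrict (Ioi (0 : ℝ))), 0 < v ξ)
    (hvC : Measurable vC) (hposC : ∀ᵐ ξ ∂(volume.restrict (Ioi (0 : ℝ))), 0 < vC ξ)
    (hint : IntegrableOn v (Ioi 0)) (hintC : IntegrableOn vC (Ioi 0))
    (hratio : IntegrableOn (fun ξ => vC ξ ^ 2 / v ξ) (Ioi 0)) :
    (1 + η) * ∫ ξ, markDefect η vC v ξ ∂(lossMeasure vC)
      = (∫ ξ, markDefect η vC v ξ ∂(lossMeasure v))
        - ∫ ξ, markDefect η vC v ξ ^ 2 ∂(lossMeasure v) := by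
  have h1 := (integrable_lossMeasure_iff hv hpos _).1
    (integrable_markDefect η hv hpos hint hintC)
  have h2 := ((integrable_lossMeasure_iff hvC hposC _).1
    (integrable_markDefect_counterparty η hpos hvC hposC hintC hratio)).const_mul (1 + η)
  have h3 : (fun ξ => v ξ * markDefect η vC v ξ - (1 + η) * (vC ξ * markDefect η vC v ξ))
      =ᵐ[volume.restrict (Ioi 0)] fun ξ => v ξ * markDefect η vC v ξ ^ 2 := by
    filter_upwards [hpos] with ξ hξ
    simp only [markDefect]
    field_simp
  rw [integral_lossMeasure hv hpos, integral_lossMeasure hv hpos, integral_lossMeasure hvC hposC,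
    ← integral_congr_ae h3, integral_sub h1 h2, integral_const_mul]
  ring

end LossMeasure

/-! ### Jump integrals against finite point measures -/

section FinitePointMeasure

variable {S : Finset (ℝ × ℝ)}

theorem integrable_finset_sum_dirac (H : ℝ × ℝ → ℝ) :
    Integrable H (∑ p ∈ S, Measure.dirac p) :=
  integrable_finsetSum_measure.2 fun p _ => integrable_dirac (by simp)

theorem integral_finset_sum_dirac (H : ℝ × ℝ → ℝ) :
    ∫ p, H p ∂(∑ p ∈ S, Measure.dirac p) = ∑ p ∈ S, H p := by
  rw [integral_finsetSum_measure fun p _ => integrable_dirac (by simp)]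
  simp

theorem jumpIntegral_sum_dirac {T : ℝ} (hS : (S : Set (ℝ × ℝ)) ⊆ Ioi 0 ×ˢ Ioc 0 T)
    (H : ℝ × ℝ → ℝ) (t : ℝ) :
    jumpIntegral (∑ p ∈ S, Measure.dirac p) H t = jumpSum S Prod.snd H t := by
  rw [jumpIntegral, ← integral_indicator (measurableSet_Ioi.prod measurableSet_Ioc),
    integral_finset_sum_dirac, jumpSum, Finset.sum_filter]
  refine Finset.sum_congr rfl fun p hp => ?_
  have h := hS hp
  by_cases ht : p.2 ≤ t
  · rw [if_pos ht, indicator_of_mem (by exact ⟨h.1, h.2.1, ht⟩)]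
  · rw [if_neg ht, indicator_of_notMem (fun h' => ht h'.2.2)]

end FinitePointMeasure

/-! ### The auxiliary equation along one path -/

section Auxiliary

variable {S : Finset (ℝ × ℝ)} {T : ℝ}

theorem auxiliary_path_iff (hT : 0 ≤ T) (hS : (S : Set (ℝ × ℝ)) ⊆ Ioi 0 ×ˢ Ioc 0 T)
    (hinj : InjOn Prod.snd (S : Set (ℝ × ℝ))) {v : ℝ → ℝ} [IsFiniteMeasure (lossMeasure v)]
    {D : ℝ → ℝ} (hD : Integrable D (lossMeasure v)) {L : ℝ × ℝ → ℝ}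
    (hL : ∀ p ∈ S, Real.exp (L p) = 1 - D p.1) {b : ℝ → ℝ → ℝ}
    (hb : ∀ s ξ, 1 - b s ξ / v ξ = D ξ) (z : ℝ → ℝ) :
    (IsCadlagOn z T ∧
      JumpIntegrable (∑ p ∈ S, Measure.dirac p) (auxIntegrand v b z) T ∧
      Integrable (auxIntegrand v b z) (lossIntensity v T) ∧
      ∀ t ∈ Icc 0 T, z t = 1 - compensatedIntegral (∑ p ∈ S, Measure.dirac p) v
        (auxIntegrand v b z) t) ↔
    ∀ t ∈ Icc 0 T, z t = expPath (∫ ξ, D ξ ∂(lossMeasure v)) S Prod.snd L t := by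
  have hH : auxIntegrand v b z = fun p => Function.leftLim z p.2 * D p.1 := by
    funext p
    rw [auxIntegrand, hb]
  rw [hH]
  set a := ∫ ξ, D ξ ∂(lossMeasure v) with ha
  have hcomp : ∀ t, 1 - compensatedIntegral (∑ p ∈ S, Measure.dirac p) v
      (fun p => Function.leftLim z p.2 * D p.1) t
      = 1 + (∫ s in Ioc 0 t, a * Function.leftLim z s)
        - jumpSum S Prod.snd (fun p => Function.leftLim z p.2 * D p.1) t := by
    intro t
    rw [compensatedIntegral, jumpIntegral_sum_dirac hS]
    simp only [integral_const_mul, integral_mul_const]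
    rw [← ha]
    ring
  simp only [hcomp]
  have hτ : ∀ p ∈ S, 0 < p.2 := fun p hp => (hS hp).2.1
  constructor
  · rintro ⟨hz, -, hint, heq⟩
    refine eq_expPath_of_integral_eq hT hτ hinj hL hz ?_ heq
    -- Integrating out the mark by Fubini makes the drift integrable in time.
    refine hint.integral_prod_right.congr (ae_of_all _ fun s => ?_)
    simp only [integral_const_mul]
    exact mul_comm _ _
  · intro hz
    have hlim : ∀ t ∈ Ioc 0 T, Function.leftLim z t = expPathLeft a S Prod.snd L t := fun t ht =>
      leftLim_eq_expPathLeft a S Prod.snd L hz ht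
    refine ⟨(isCadlagOn_expPath a S Prod.snd L T).congr hz, (integrable_finset_sum_dirac _).integrableOn,
      ?_, fun t ht => ?_⟩
    · refine (hD.mul_prod (integrableOn_expPathLeft a S Prod.snd L T)).congr ?_
      filter_upwards [Measure.quasiMeasurePreserving_snd.ae
        (ae_restrict_mem (measurableSet_Ioc (a := 0) (b := T)))] with p hp
      rw [hlim _ hp, mul_comm]
    · rw [hz t ht, expPath_integral_eq hτ hinj hL ht.1]
      congr 1
      · congr 1
        refine setIntegral_congr_fun measurableSet_Ioc fun s hs => ?_
        simp only [hlim s ⟨hs.1, hs.2.trans ht.2⟩]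
      · refine Finset.sum_congr rfl fun p hp => ?_
        simp only [hlim p.2 (hS (Finset.mem_filter.1 hp).1).2]

end Auxiliary

/-! ### The wealth equation along one path -/

section Wealth

variable {S : Finset (ℝ × ℝ)} {T : ℝ} {κ : Type*} [Fintype κ]

/-- The wealth equation when the retained loss is `ξ - ∑ₖ uₖ E'ₖ(s-) D'ₖ(ξ)`, where `E'ₖ` is an
exponential path of slope `rₖ`, in closed form. -/
theorem wealth_path_iff (hS : (S : Set (ℝ × ℝ)) ⊆ Ioi 0 ×ˢ Ioc 0 T)
    (hinj : InjOn Prod.snd (S : Set (ℝ × ℝ))) {vC : ℝ → ℝ} [IsFiniteMeasure (lossMeasure vC)]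
    (hid : Integrable (fun ξ : ℝ => ξ) (lossMeasure vC))
    {D : κ → ℝ → ℝ} (hD : ∀ k, Integrable (D k) (lossMeasure vC)) {L : κ → ℝ × ℝ → ℝ}
    (hL : ∀ k, ∀ p ∈ S, Real.exp (L k p) = 1 - D k p.1) {c η x : ℝ} {r u : κ → ℝ}
    (hr : ∀ k, (1 + η) * ∫ ξ, D k ξ ∂(lossMeasure vC) = r k) {α : ℝ → ℝ → ℝ}
    (hα : ∀ s ∈ Ioc 0 T, ∀ ξ,
      α s ξ = ξ + ∑ k, u k * (expPathLeft (r k) S Prod.snd (L k) s * D k ξ)) (X : ℝ → ℝ) :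
    (IsCadlagOn X T ∧
      JumpIntegrable (∑ p ∈ S, Measure.dirac p) (fun p => p.1 - α p.2 p.1) T ∧
      Integrable (fun p : ℝ × ℝ => α p.2 p.1) (lossIntensity vC T) ∧
      ∀ t ∈ Icc 0 T, X t = x + (∫ s in Ioc 0 t, (c - (1 + η) * ∫ ξ, α s ξ ∂(lossMeasure vC)))
        - jumpIntegral (∑ p ∈ S, Measure.dirac p) (fun p => p.1 - α p.2 p.1) t) ↔
    ∀ t ∈ Icc 0 T, X t = x + (c - (1 + η) * ∫ ξ, ξ ∂(lossMeasure vC)) * t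
      + ∑ k, u k * (1 - expPath (r k) S Prod.snd (L k) t) := by
  set E : κ → ℝ → ℝ := fun k => expPathLeft (r k) S Prod.snd (L k)
  have hτ : ∀ p ∈ S, 0 < p.2 := fun p hp => (hS hp).2.1
  have hinner : ∀ s ∈ Ioc 0 T, c - (1 + η) * ∫ ξ, α s ξ ∂(lossMeasure vC)
      = (c - (1 + η) * ∫ ξ, ξ ∂(lossMeasure vC)) - ∑ k, u k * (r k * E k s) := by
    intro s hs
    simp only [hα s hs]
    have hterm : ∀ k ∈ Finset.univ,
        Integrable (fun ξ => u k * (E k s * D k ξ)) (lossMeasure vC) :=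
      fun k _ => ((hD k).const_mul _).const_mul _
    rw [integral_add hid (integrable_finsetSum _ hterm), integral_finsetSum _ hterm, mul_add,
      Finset.mul_sum, ← sub_sub]
    congr 1
    refine Finset.sum_congr rfl fun k _ => ?_
    rw [integral_const_mul, integral_const_mul, ← hr k]
    ring
  have hdrift : ∀ t ∈ Icc 0 T,
      ∫ s in Ioc 0 t, (c - (1 + η) * ∫ ξ, α s ξ ∂(lossMeasure vC))
        = (c - (1 + η) * ∫ ξ, ξ ∂(lossMeasure vC)) * t
          - ∑ k, u k * ∫ s in Ioc 0 t, r k * E k s := by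
    intro t ht
    have hterm : ∀ k ∈ Finset.univ,
        Integrable (fun s => u k * (r k * E k s)) (volume.restrict (Ioc 0 t)) :=
      fun k _ => ((integrableOn_expPathLeft _ _ _ _ t).const_mul _).const_mul _
    rw [setIntegral_congr_fun measurableSet_Ioc fun s hs => hinner s ⟨hs.1, hs.2.trans ht.2⟩,
      integral_sub (integrable_const _) (integrable_finsetSum _ hterm),
      integral_finsetSum _ hterm]
    congr 1
    · simp [ht.1, mul_comm]
    · exact Finset.sum_congr rfl fun k _ => integral_const_mul _ _
  have hjump : ∀ t, jumpIntegral (∑ p ∈ S, Measure.dirac p) (fun p => p.1 - α p.2 p.1) t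
      = - ∑ k, u k * jumpSum S Prod.snd (fun p => E k p.2 * D k p.1) t := by
    intro t
    rw [jumpIntegral_sum_dirac hS]
    simp only [jumpSum, Finset.mul_sum]
    rw [Finset.sum_comm, ← Finset.sum_neg_distrib]
    refine Finset.sum_congr rfl fun p hp => ?_
    rw [hα p.2 (hS (Finset.mem_filter.1 hp).1).2]
    ring
  have hclosed : ∀ t ∈ Icc 0 T,
      x + (∫ s in Ioc 0 t, (c - (1 + η) * ∫ ξ, α s ξ ∂(lossMeasure vC)))
        - jumpIntegral (∑ p ∈ S, Measure.dirac p) (fun p => p.1 - α p.2 p.1) t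
      = x + (c - (1 + η) * ∫ ξ, ξ ∂(lossMeasure vC)) * t
        + ∑ k, u k * (1 - expPath (r k) S Prod.snd (L k) t) := by
    intro t ht
    -- The linear equation for the path of slope `r k`, solved for its total change, pairs the drift
    -- and jump contributions of each model.
    have hk : ∀ k, u k * (1 - expPath (r k) S Prod.snd (L k) t)
        = u k * jumpSum S Prod.snd (fun p => E k p.2 * D k p.1) t
          - u k * ∫ s in Ioc 0 t, r k * E k s := by
      intro k
      rw [expPath_integral_eq (g := fun p => D k p.1) hτ hinj (hL k) ht.1]
      ring
    rw [hdrift t ht, hjump t]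
    simp only [hk, Finset.sum_sub_distrib]
    ring
  constructor
  · rintro ⟨-, -, -, heq⟩ t ht
    rw [heq t ht, hclosed t ht]
  · intro hX
    refine ⟨?_, (integrable_finset_sum_dirac _).integrableOn, ?_, fun t ht => ?_⟩
    · refine IsCadlagOn.congr ⟨fun t ht => ?_, fun t ht => ?_⟩ hX
      · refine ContinuousWithinAt.add (by fun_prop) (tendsto_finsetSum _ fun k _ => ?_)
        exact (((isCadlagOn_expPath _ _ _ _ T).1 t ht).const_sub 1).const_mul _
      · refine ⟨_, Tendsto.add (Continuous.continuousWithinAt (by fun_prop))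
          (tendsto_finsetSum _ fun k _ =>
            ((tendsto_expPath_left (r k) S Prod.snd (L k) t).const_sub 1).const_mul (u k))⟩
    · have hterm : ∀ k ∈ Finset.univ,
          Integrable (fun p : ℝ × ℝ => u k * (D k p.1 * E k p.2)) (lossIntensity vC T) :=
        fun k _ => ((hD k).mul_prod (integrableOn_expPathLeft _ _ _ _ T)).const_mul _
      have hfst : Integrable (fun p : ℝ × ℝ => p.1) (lossIntensity vC T) := hid.comp_fst _
      refine (hfst.add (integrable_finsetSum _ hterm)).congr ?_
      filter_upwards [Measure.quasiMeasurePreserving_snd.ae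
        (ae_restrict_mem (measurableSet_Ioc (a := 0) (b := T)))] with p hp
      simp only [Pi.add_apply, hα _ hp]
      congr 1
      exact Finset.sum_congr rfl fun k _ => by rw [mul_comm (D k p.1)]
    · rw [hX t ht, hclosed t ht]

end Wealth

/-! ### Almost sure regularity of the samples -/

section Sample

variable {n : ℕ}

/-- The measure `m` is a finite sum of unit masses at points of `(0, ∞) × (0, T]` with distinct
times, and all the densities are positive at their marks. -/
def IsRegularSample (v : ModelIndex n → ℝ → ℝ) (T : ℝ) (m : Measure (ℝ × ℝ)) : Prop :=
  ∃ S : Finset (ℝ × ℝ), (S : Set (ℝ × ℝ)) ⊆ Ioi 0 ×ˢ Ioc 0 T ∧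
    InjOn Prod.snd (S : Set (ℝ × ℝ)) ∧ (∀ p ∈ S, ∀ k, 0 < v k p.1) ∧
    m = ∑ p ∈ S, Measure.dirac p

theorem IsPoissonRandomMeasure.ae_isRegularSample {Ω : Type*} [MeasurableSpace Ω]
    {P : Measure Ω} {T : ℝ} (hT : 0 < T) {v : ModelIndex n → ℝ → ℝ}
    (hv_meas : ∀ k, Measurable (v k))
    (hv_pos : ∀ k, ∀ᵐ ξ ∂(volume.restrict (Ioi (0 : ℝ))), 0 < v k ξ) {v₀ : ℝ → ℝ}
    (hint : IntegrableOn v₀ (Ioi 0)) {N : Ω → Measure (ℝ × ℝ)}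
    (hN : IsPoissonRandomMeasure P N (lossIntensity v₀ T)) :
    ∀ᵐ ω ∂P, IsRegularSample v T (N ω) := by
  have := isFiniteMeasure_lossMeasure hint
  -- The good region has full intensity because each density is positive almost everywhere and there
  -- are finitely many of them.
  set G : Set (ℝ × ℝ) := ({ξ | ∀ k, 0 < v k ξ} ∩ Ioi 0) ×ˢ Ioc 0 T
  have hGm : MeasurableSet G := by
    refine MeasurableSet.prod (MeasurableSet.inter ?_ measurableSet_Ioi) measurableSet_Ioc
    have : {ξ | ∀ k, 0 < v k ξ} = ⋂ k, {ξ | 0 < v k ξ} := by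
      ext ξ
      simp
    rw [this]
    exact MeasurableSet.iInter fun k => measurableSet_lt measurable_const (hv_meas k)
  have hG0 : lossIntensity v₀ T Gᶜ = 0 := by
    have h1 : ∀ᵐ ξ ∂(lossMeasure v₀), ξ ∈ {ξ | ∀ k, 0 < v k ξ} ∩ Ioi 0 :=
      ae_lossMeasure ((ae_all_iff.2 hv_pos).and (ae_restrict_mem measurableSet_Ioi))
    have h2 : ∀ᵐ p ∂(lossIntensity v₀ T), p ∈ G := by
      filter_upwards [Measure.quasiMeasurePreserving_fst.ae h1,
        Measure.quasiMeasurePreserving_snd.ae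
          (ae_restrict_mem (measurableSet_Ioc (a := 0) (b := T)))] with p hp hp'
      exact ⟨hp, hp'⟩
    exact h2
  have htop : lossIntensity v₀ T univ < ⊤ := by
    rw [lossIntensity]
    exact measure_lt_top _ _
  filter_upwards [hN.isPointMeasure, hN.ae_lt_top MeasurableSet.univ htop,
    hN.ae_eq_zero hGm.compl hG0, hN.ae_exists_separating] with ω h1 h2 h3 h4
  obtain ⟨S, hSG, hinj, hS⟩ := h1.exists_finset hT h2 h3 (fun p hp => hp.2) h4
  exact ⟨S, fun p hp => ⟨(hSG hp).1.2, (hSG hp).2⟩, hinj, fun p hp k => (hSG hp).1.1 k, hS⟩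

end Sample

theorem exp_log_ratio {η a b : ℝ} (hη : 0 < η) (ha : 0 < a) (hb : 0 < b) :
    Real.exp (Real.log ((1 + η) * (a / b))) = 1 - (1 - (1 + η) * (a / b)) := by
  rw [Real.exp_log (by positivity)]
  ring

end

/-! ### Assembly of the main theorem -/

theorem mainTheorem3 {Ω : Type*} [MeasurableSpace Ω] {n : ℕ}
    (P : ModelIndex n → Measure Ω) [∀ k, IsProbabilityMeasure (P k)]
    (hP : ∀ j k, P j ≪ P k)
    (T : ℝ) (hT : 0 < T)
    (v : ModelIndex n → ℝ → ℝ) (hv_meas : ∀ k, Measurable (v k))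
    (hv_pos : ∀ k, ∀ᵐ ξ ∂(volume.restrict (Ioi (0 : ℝ))), 0 < v k ξ)
    (hv_int : ∀ k, IntegrableOn (v k) (Ioi 0))
    (hv_mean : ∀ k, IntegrableOn (fun ξ => ξ * v k ξ) (Ioi 0))
    (hv_ratio : ∀ k, IntegrableOn (fun ξ => v none ξ ^ 2 / v k ξ) (Ioi 0))
    (N : Ω → Measure (ℝ × ℝ))
    (hN : ∀ k, IsPoissonRandomMeasure (P k) N (lossIntensity (v k) T))
    (w : ModelIndex n → ℝ) (hw_nonneg : ∀ k, 0 ≤ w k) (hw_sum : ∑ k, w k = 1)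
    (c η θ x : ℝ) (hc : 0 < c) (hη : 0 < η) (hθ : 0 < θ) (hx : 0 < x) :
    (∀ k, ∀ᵐ ω ∂(P none),
      JumpIntegrable (N ω) (fun p => Real.log ((1 + η) * (v none p.1 / v k p.1))) T) ∧
    ∀ (Z : ModelIndex n → ℝ → Ω → ℝ) (X : ℝ → Ω → ℝ),
      AreOptimalProcesses P N v w T c η θ x Z X ↔
        ∀ᵐ ω ∂(P none), ∀ t ∈ Icc 0 T,
          (∀ k, Z k t ω
            = Real.exp (t * (∫ ξ in Ioi 0, (v k ξ - (1 + η) * v none ξ))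
                + jumpIntegral (N ω)
                    (fun p => Real.log ((1 + η) * (v none p.1 / v k p.1))) t)) ∧
          X t ω
            = x + (c - (1 + η) * ∫ ξ, ξ ∂(lossMeasure (v none))) * t
              + 1 / θ * ∑ k, w k * ell η (v none) (v k) T
                  * (1 - ell η (v none) (v k) (-t) * Z k t ω) := by
  have hreg : ∀ᵐ ω ∂(P none), IsRegularSample v T (N ω) :=
    (hN none).ae_isRegularSample hT hv_meas hv_pos (hv_int none)
  have hfin : ∀ k, IsFiniteMeasure (lossMeasure (v k)) := fun k =>
    isFiniteMeasure_lossMeasure (hv_int k)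
  refine ⟨fun k => ?_, fun Z X => ?_⟩
  · filter_upwards [hreg] with ω ⟨S, _, _, _, hS⟩
    rw [JumpIntegrable, hS]
    exact (integrable_finset_sum_dirac _).integrableOn
  set L : ModelIndex n → ℝ × ℝ → ℝ := fun k p =>
    Real.log ((1 + η) * (v none p.1 / v k p.1))
  set D : ModelIndex n → ℝ → ℝ := fun k => markDefect η (v none) (v k) with hDdef
  set a : ModelIndex n → ℝ := fun k => ∫ ξ, D k ξ ∂(lossMeasure (v k))
  set q : ModelIndex n → ℝ := fun k => ∫ ξ, D k ξ ^ 2 ∂(lossMeasure (v k))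
  have hell : ∀ k t, ell η (v none) (v k) t = Real.exp (t * q k) := fun k t => rfl
  have hDk : ∀ k, Integrable (D k) (lossMeasure (v k)) := fun k =>
    integrable_markDefect η (hv_meas k) (hv_pos k) (hv_int k) (hv_int none)
  have hDC : ∀ k, Integrable (D k) (lossMeasure (v none)) := fun k =>
    integrable_markDefect_counterparty η (hv_pos k) (hv_meas none) (hv_pos none) (hv_int none)
      (hv_ratio k)
  have hr : ∀ k, (1 + η) * ∫ ξ, D k ξ ∂(lossMeasure (v none)) = a k + -q k := fun k =>
    integral_markDefect_counterparty η (hv_meas k) (hv_pos k) (hv_meas none) (hv_pos none)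
      (hv_int k) (hv_int none) (hv_ratio k)
  have hid : Integrable (fun ξ : ℝ => ξ) (lossMeasure (v none)) := by
    rw [integrable_lossMeasure_iff (hv_meas none) (hv_pos none)]
    exact (hv_mean none).congr (ae_of_all _ fun ξ => mul_comm _ _)
  simp only [← integral_markDefect η (hv_meas _) (hv_pos _)]
  have hZ : ∀ k, IsAuxiliaryProcess (P k) N (v k) T (fun _ ξ _ => betaStar η v ξ) (Z k) ↔
      ∀ᵐ ω ∂(P none), ∀ t ∈ Icc 0 T,
        Z k t ω = Real.exp (t * a k + jumpIntegral (N ω) (L k) t) := by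
    intro k
    -- Equivalent measures have the same null sets, so every auxiliary equation can be tested under
    -- `P none`.
    have hae : ae (P k) = ae (P none) :=
      le_antisymm (hP k none).ae_le (hP none k).ae_le
    rw [IsAuxiliaryProcess, hae]
    refine eventually_congr ?_
    filter_upwards [hreg] with ω ⟨S, hS, hinj, hpos, hNS⟩
    rw [hNS, auxiliary_path_iff hT.le hS hinj (hDk k)
      (fun p hp => exp_log_ratio hη (hpos p hp none) (hpos p hp k))
      (fun s ξ => by simp only [betaStar, hDdef, markDefect, mul_div_assoc])]
    refine forall₂_congr fun t _ => ?_
    rw [jumpIntegral_sum_dirac hS, expPath, mul_comm t]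
  -- The strategy feeds back `Z_{t-}`, so the wealth equation can be solved only once `Z` is known
  -- explicitly.
  have hX : (∀ᵐ ω ∂(P none), ∀ k, ∀ t ∈ Icc 0 T,
        Z k t ω = Real.exp (t * a k + jumpIntegral (N ω) (L k) t)) →
      (IsWealthProcess (P none) N (v none) T c η x
        (fun t ξ ω => alphaStar η θ T w v t ξ
          fun k => Function.leftLim (fun s => Z k s ω) t) X ↔
      ∀ᵐ ω ∂(P none), ∀ t ∈ Icc 0 T,
        X t ω = x + (c - (1 + η) * ∫ ξ, ξ ∂(lossMeasure (v none))) * t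
          + 1 / θ * ∑ k, w k * ell η (v none) (v k) T
            * (1 - ell η (v none) (v k) (-t) * Z k t ω)) := by
    intro hZω
    refine eventually_congr ?_
    filter_upwards [hreg, hZω] with ω ⟨S, hS, hinj, hpos, hNS⟩ hZω
    have hZE : ∀ k, ∀ t ∈ Icc 0 T, Z k t ω = expPath (a k) S Prod.snd (L k) t := by
      intro k t ht
      rw [hZω k t ht, hNS, jumpIntegral_sum_dirac hS, expPath, mul_comm t]
    rw [hNS]
    refine (wealth_path_iff hS hinj hid hDC (L := L)
      (fun k p hp => exp_log_ratio hη (hpos p hp none) (hpos p hp k)) hr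
      -- Splitting `ℓ_k(T - s) = exp (T q k) * exp (-q k s)`, the constant factor goes into `u` and
      -- the other turns slope `a k` into `a k - q k`.
      (u := fun k => 1 / θ * (w k * Real.exp (T * q k)))
      (α := fun t ξ => alphaStar η θ T w v t ξ fun k => Function.leftLim (fun s => Z k s ω) t)
      (fun s hs ξ => ?_) fun t => X t ω).trans ?_
    · rw [alphaStar, sub_eq_add_neg, Finset.mul_sum, ← Finset.sum_neg_distrib]
      refine congrArg _ (Finset.sum_congr rfl fun k _ => ?_)
      rw [leftLim_eq_expPathLeft (a k) S Prod.snd (L k) (hZE k) hs, expPathLeft_eq_mul, hell,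
        show (T - s) * q k = T * q k + -q k * s by ring, Real.exp_add]
      simp only [hDdef, markDefect]
      ring
    · refine forall₂_congr fun t ht => ?_
      rw [Finset.mul_sum]
      refine Eq.congr_right (congrArg _ (Finset.sum_congr rfl fun k _ => ?_))
      rw [hZE k t ht, expPath_eq_mul_exp, hell, hell]
      ring_nf
  rw [AreOptimalProcesses]
  constructor
  · rintro ⟨h1, h2⟩
    have h3 := ae_all_iff.2 fun k => (hZ k).1 (h1 k)
    filter_upwards [h3, (hX h3).1 h2] with ω h4 h5 t ht
    exact ⟨fun k => h4 k t ht, h5 t ht⟩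
  · intro h
    have h3 : ∀ᵐ ω ∂(P none), ∀ k, ∀ t ∈ Icc 0 T,
        Z k t ω = Real.exp (t * a k + jumpIntegral (N ω) (L k) t) :=
      h.mono fun ω hω k t ht => (hω t ht).1 k
    exact ⟨fun k => (hZ k).2 (h3.mono fun ω hω => hω k),
      (hX h3).2 (h.mono fun ω hω t ht => (hω t ht).2)⟩
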